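/- Let $k$ be a field of characteristic zero and let $\mathfrak{g}$ be a finite-dimensional Lie algebra over $k$ which is generated as a Lie algebra by two elements and is two-step solvable, i.e. $[[\mathfrak{g},\mathfrak{g}],[\mathfrak{g},\mathfrak{g}]]=0$. Then $\mathfrak{g}$ admits a complete LR-structure: there is a $k$-bilinear product $(x,y)\mapsto x\cdot y$ on $\mathfrak{g}$ such that for all $x,y,z\in\mathfrak{g}$ $$x\cdot(y\cdot z)=y\cdot(x\cdot z),\qquad (x\cdot y)\cdot z=(x\cdot z)\cdot y,\qquad x\cdot y-y\cdot x=[x,y],$$ and such that every right multiplication $R(x)\colon \mathfrak{g}\to\mathfrak{g}$, $y\mapsto y\cdot x$, is a nilpotent operator. -/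

import Mathlib

/-- A bilinear product `x · y = μ x y` on a vector space is an *LR-product* if all left
multiplications commute with each other and all right multiplications commute with each other. -/
structure IsLRProduct {K A : Type*} [Field K] [AddCommGroup A] [Module K A]
    (μ : A →ₗ[K] A →ₗ[K] A) : Prop where
  left_comm : ∀ x y z : A, μ x (μ y z) = μ y (μ x z)
  right_comm : ∀ x y z : A, μ (μ x y) z = μ (μ x z) y

/-- An *LR-structure* on a Lie algebra `L`: an LR-product on the vector space `L` whose commutator
is the given Lie bracket. -/
structure IsLRStructure {K L : Type*} [Field K] [LieRing L] [LieAlgebra K L]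
    (μ : L →ₗ[K] L →ₗ[K] L) : Prop extends IsLRProduct μ where
  commutator_eq : ∀ x y : L, μ x y - μ y x = ⁅x, y⁆

/-- An LR-structure is *complete* if every right multiplication `R(x) : y ↦ y · x` is a
nilpotent endomorphism. -/
structure IsCompleteLRStructure {K L : Type*} [Field K] [LieRing L] [LieAlgebra K L]
    (μ : L →ₗ[K] L →ₗ[K] L) : Prop extends IsLRStructure μ where
  isNilpotent_right : ∀ x : L, IsNilpotent (μ.flip x : Module.End K L)

/-- A Lie algebra is *two-generated* if two of its elements generate it as a Lie algebra. -/
def IsTwoGenerated (K L : Type*) [Field K] [LieRing L] [LieAlgebra K L] : Prop :=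
  ∃ x y : L, LieSubalgebra.lieSpan K L {x, y} = ⊤

/-- A Lie algebra is *two-step solvable* if the second term of its derived series,
`[[L, L], [L, L]]`, is zero. -/
def IsTwoStepSolvable (K L : Type*) [Field K] [LieRing L] [LieAlgebra K L] : Prop :=
  LieAlgebra.derivedSeries K L 2 = ⊥

/-! Let M = [L, L], an abelian ideal. If M has codimension at most one, a product u · v = f(u)[z, v]
with f a functional killing M suffices. Otherwise ad x and ad y generate a commutative algebra A
acting faithfully on M = A[x, y], so M ≅ A and L = Kx ⊕ Ky ⊕ A with [x, y] = 1. There the bracket is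
written as α(u)β(v) − α(v)β(u), with α, β : L → A restricting on A to multiplication by d and by b =
X + tY. The product α(u)β(v) is LR because A is commutative, and complete once d is nilpotent. This
works with d = bc − Y: for generic t every prime containing b contains Y, so Y is a multiple of b
modulo nilpotents. Characteristic zero serves only to make K infinite. -/

section CommutativeAlgebra

/-- In a finite-dimensional commutative algebra over an infinite field, a generic translate
`x + t y` lies only in those primes which contain `y` as well. -/
theorem exists_add_smul_mem_prime_imp {K A : Type*} [Field K] [Infinite K] [CommRing A]
    [Algebra K A] [FiniteDimensional K A] (x y : A) :
    ∃ t : K, ∀ P : Ideal A, P.IsPrime → x + t • y ∈ P → y ∈ P := by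
  classical
  have : IsArtinianRing A := IsArtinianRing.of_finite K A
  by_contra! h
  choose P hP hx hy using h
  let f : K → PrimeSpectrum A := fun t ↦ ⟨P t, hP t⟩
  -- An artinian ring has finitely many primes, so two values of the parameter share one.
  obtain ⟨s, t, hst, hf⟩ := Finite.exists_ne_map_eq_of_infinite f
  have hPst : P s = P t := congrArg PrimeSpectrum.asIdeal hf
  have h1 : (s - t) • y ∈ P s := by
    have h2 := (P s).sub_mem (hx s) (hPst ▸ hx t)
    have h3 : x + s • y - (x + t • y) = (s - t) • y := by rw [sub_smul]; abel
    rwa [h3] at h2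
  refine hy s ?_
  have h4 := Submodule.smul_of_tower_mem (P s) (s - t)⁻¹ h1
  rwa [smul_smul, inv_mul_cancel₀ (sub_ne_zero.2 hst), one_smul] at h4

/-- In an artinian ring, if `y` lies in every prime containing `x`, then `y` is a multiple of `x`
up to a nilpotent element. -/
theorem exists_isNilpotent_mul_sub {A : Type*} [CommRing A] [IsArtinianRing A] {x y : A}
    (h : ∀ P : Ideal A, P.IsPrime → x ∈ P → y ∈ P) :
    ∃ c : A, IsNilpotent (x * c - y) := by
  -- The chain of ideals (x ^ n) stabilizes, so x ^ n = x ^ (n + 1) * e: modulo a prime avoiding x,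
  -- e is inverse to x.
  obtain ⟨n, e, he⟩ := IsArtinian.exists_pow_succ_smul_dvd x (1 : A)
  simp only [smul_eq_mul, mul_one, Nat.succ_eq_add_one, pow_succ] at he
  refine ⟨e * y, nilpotent_iff_mem_prime.2 fun P hP ↦ ?_⟩
  by_cases hx : x ∈ P
  · exact P.sub_mem (P.mul_mem_right _ hx) (h P hP hx)
  · have h0 : x ^ n * (x * (e * y) - y) = 0 := by linear_combination y * he
    exact (hP.mem_or_mem (h0 ▸ P.zero_mem)).resolve_left fun hn ↦ hx (hP.mem_of_pow_mem n hn)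

open scoped IsMulCommutative in
/-- Two commuting endomorphisms generate a commutative algebra of endomorphisms. -/
theorem exists_commRing_injective_algHom_end.{u, v} {K : Type u} {M : Type v} [Field K] [AddCommGroup M]
    [Module K M] [FiniteDimensional K M] (X Y : Module.End K M) (hXY : X * Y = Y * X) :
    ∃ (A : Type v) (_ : CommRing A) (_ : Algebra K A) (ρ : A →ₐ[K] Module.End K M) (x y : A),
      Function.Injective ρ ∧ ρ x = X ∧ ρ y = Y := by
  have hcomm : ∀ a ∈ ({X, Y} : Set (Module.End K M)), ∀ b ∈ ({X, Y} : Set (Module.End K M)),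
      a * b = b * a := by
    rintro a (rfl | rfl) b (rfl | rfl) <;> first | rfl | exact hXY | exact hXY.symm
  have := Algebra.isMulCommutative_adjoin K hcomm
  exact ⟨Algebra.adjoin K {X, Y}, inferInstance, inferInstance,
    (Algebra.adjoin K {X, Y}).val, ⟨X, Algebra.subset_adjoin (by simp)⟩,
    ⟨Y, Algebra.subset_adjoin (by simp)⟩, Subtype.val_injective, rfl, rfl⟩

end CommutativeAlgebra

/-! ### Construction of LR-structures from explicit products -/

section LRStructures

variable {K L : Type*} [Field K] [LieRing L] [LieAlgebra K L]

/-- The product `u · v = e (α u * β v)`, for `e : A → L` linear on a commutative algebra `A`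
with `α (e a) = d * a` and `β (e a) = x * a`, `d` nilpotent, is a complete LR-structure. -/
theorem exists_isCompleteLRStructure_of_factorization {A : Type*} [CommRing A] [Algebra K A]
    (e : A →ₗ[K] L) (α β : L →ₗ[K] A) (d x : A) (hd : IsNilpotent d)
    (hα : ∀ a, α (e a) = d * a) (hβ : ∀ a, β (e a) = x * a)
    (hbr : ∀ u v : L, ⁅u, v⁆ = e (α u * β v - α v * β u)) :
    ∃ μ : L →ₗ[K] L →ₗ[K] L, IsCompleteLRStructure μ := by
  let μ : L →ₗ[K] L →ₗ[K] L := ((LinearMap.mul K A).compl₁₂ α β).compr₂ e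
  have hμ : ∀ u v, μ u v = e (α u * β v) := fun _ _ ↦ rfl
  refine ⟨μ, ⟨⟨⟨fun u v z ↦ ?_, fun u v z ↦ ?_⟩, fun u v ↦ ?_⟩, fun z ↦ ?_⟩⟩
  · simp only [hμ, hβ]; congr 1; ring
  · simp only [hμ, hα]; congr 1; ring
  · rw [hμ, hμ, hbr, map_sub]
  · obtain ⟨n, hn⟩ := hd
    -- The first multiplication contributes α u and each later one a factor d, hence m against m +
    -- 1.
    have key : ∀ (m : ℕ) (u : L),
        ((μ.flip z : Module.End K L) ^ (m + 1)) u = e (d ^ m * (α u * β z ^ (m + 1))) := by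
      intro m u
      induction m with
      | zero => simp [hμ]
      | succ m ih =>
        rw [pow_succ', Module.End.mul_apply, ih, LinearMap.flip_apply, hμ, hα]
        congr 1; ring
    refine ⟨n + 1, LinearMap.ext fun u ↦ ?_⟩
    rw [key, hn, zero_mul, map_zero, LinearMap.zero_apply]

/-- A Lie algebra `⟨x, y⟩ ⊕ A`, where `A` is a finite-dimensional commutative algebra on which
`x` and `y` act by multiplication with `X` and `Y`, and `⁅x, y⁆ = 1`, has a complete
LR-structure. -/
theorem exists_isCompleteLRStructure_of_coordinates [Infinite K] {A : Type*} [CommRing A]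
    [Algebra K A] [FiniteDimensional K A] (X Y : A) (e : A →ₗ[K] L) (p q : L →ₗ[K] K)
    (s : L →ₗ[K] A) (hp : ∀ a, p (e a) = 0) (hq : ∀ a, q (e a) = 0) (hs : ∀ a, s (e a) = a)
    (hbr : ∀ u v : L, ⁅u, v⁆ = e (algebraMap K A (p u * q v - p v * q u)
      + X * (p u • s v - p v • s u) + Y * (q u • s v - q v • s u))) :
    ∃ μ : L →ₗ[K] L →ₗ[K] L, IsCompleteLRStructure μ := by
  have : IsArtinianRing A := IsArtinianRing.of_finite K A
  obtain ⟨t, ht⟩ := exists_add_smul_mem_prime_imp (K := K) X Y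
  obtain ⟨c, hc⟩ := exists_isNilpotent_mul_sub ht
  let d := (X + t • Y) * c - Y
  -- after the change of generators `x ↦ x + t y` the coordinate `q` becomes `q - t p`
  let r : L →ₗ[K] K := q - t • p
  have hr : ∀ u, r u = q u - t * p u := fun _ ↦ rfl
  -- The term c * r in α corrects the r, s part of the bracket: its coefficient is (X + t • Y) * c -
  -- d = Y.
  let α : L →ₗ[K] A := Algebra.linearMap K A ∘ₗ p + LinearMap.mulLeft K c ∘ₗ
    Algebra.linearMap K A ∘ₗ r + LinearMap.mulLeft K d ∘ₗ s
  let β : L →ₗ[K] A := Algebra.linearMap K A ∘ₗ r + LinearMap.mulLeft K (X + t • Y) ∘ₗ s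
  have hα : ∀ u, α u = algebraMap K A (p u) + c * algebraMap K A (r u) + d * s u := fun _ ↦ rfl
  have hβ : ∀ u, β u = algebraMap K A (r u) + (X + t • Y) * s u := fun _ ↦ rfl
  refine exists_isCompleteLRStructure_of_factorization e α β d (X + t • Y) hc
    (fun a ↦ ?_) (fun a ↦ ?_) fun u v ↦ ?_
  · simp [hα, hr, hp, hq, hs]
  · simp [hβ, hr, hp, hq, hs]
  · rw [hbr]
    congr 1
    simp only [hα, hβ, hr, d, Algebra.smul_def, map_sub, map_mul]
    ring

/-- A Lie algebra with an abelian ideal `M` of codimension at most one has a complete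
LR-structure. -/
theorem exists_isCompleteLRStructure_of_codim_le_one (M : LieIdeal K L)
    (hM : ∀ a ∈ M, ∀ b ∈ M, ⁅a, b⁆ = 0) (z : L) (hz : ∀ u : L, ∃ r : K, ∃ a ∈ M, u = r • z + a) :
    ∃ μ : L →ₗ[K] L →ₗ[K] L, IsCompleteLRStructure μ := by
  -- If z ∈ M then M = L is abelian, and f = 0 gives the zero product.
  obtain ⟨f, hfM, hfz⟩ : ∃ f : L →ₗ[K] K, (∀ a ∈ M, f a = 0) ∧ (f z = 1 ∨ z ∈ M) := by
    by_cases hzM : z ∈ M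
    · exact ⟨0, fun _ _ ↦ rfl, Or.inr hzM⟩
    · obtain ⟨f, hf, hle⟩ := Submodule.exists_le_ker_of_notMem (p := M.toSubmodule) hzM
      refine ⟨(f z)⁻¹ • f, fun a ha ↦ ?_, Or.inl ?_⟩
      · rw [LinearMap.smul_apply, LinearMap.mem_ker.1 (hle ha), smul_zero]
      · rw [LinearMap.smul_apply, smul_eq_mul, inv_mul_cancel₀ hf]
  let μ : L →ₗ[K] L →ₗ[K] L := f.smulRight ((LieAlgebra.ad K L z : Module.End K L))
  have hμ : ∀ u v, μ u v = f u • ⁅z, v⁆ := fun _ _ ↦ rfl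
  have hlie : ∀ u v : L, ⁅u, v⁆ ∈ M := by
    intro u v
    obtain ⟨r, a, ha, rfl⟩ := hz u
    obtain ⟨r', b, hb, rfl⟩ := hz v
    simp only [add_lie, lie_add, smul_lie, lie_smul, lie_self, smul_zero, zero_add, hM a ha b hb,
      add_zero]
    exact M.add_mem (M.smul_mem _ (lie_mem_left K L M a z ha))
      (M.smul_mem _ (lie_mem_right K L M z b hb))
  have hfl : ∀ u v : L, f ⁅u, v⁆ = 0 := fun u v ↦ hfM _ (hlie u v)
  refine ⟨μ, ⟨⟨⟨fun u v w ↦ ?_, fun u v w ↦ ?_⟩, fun u v ↦ ?_⟩, fun w ↦ ⟨2, ?_⟩⟩⟩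
  · simp only [hμ, lie_smul]; rw [smul_comm]
  · simp [hμ, hfl]
  · obtain ⟨r, a, ha, rfl⟩ := hz u
    obtain ⟨r', b, hb, rfl⟩ := hz v
    rcases hfz with h1 | h1
    · have hf : ∀ (c : K), ∀ m ∈ M, f (c • z + m) = c := fun c m hm ↦ by
        rw [map_add, map_smul, h1, hfM m hm, smul_eq_mul, mul_one, add_zero]
      rw [hμ, hμ, hf r a ha, hf r' b hb]
      simp only [add_lie, lie_add, smul_lie, lie_smul, lie_self, hM a ha b hb]
      rw [← lie_skew z a]
      module
    · have h2 : f z = 0 := hfM z h1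
      simp [hμ, h2, hfM a ha, hfM b hb, hM a ha b hb, hM z h1 b hb, hM a ha z h1]
  · ext u
    rw [pow_two]
    simp [hμ, hfl]

/-! ### Two-generated and two-step solvable Lie algebras -/

theorem lie_mem_derivedSeries_one (u v : L) : ⁅u, v⁆ ∈ LieAlgebra.derivedSeries K L 1 := by
  rw [LieAlgebra.derivedSeries_def, LieAlgebra.derivedSeriesOfIdeal_succ,
    LieAlgebra.derivedSeriesOfIdeal_zero]
  exact LieSubmodule.lie_mem_lie (LieSubmodule.mem_top u) (LieSubmodule.mem_top v)

theorem IsTwoStepSolvable.lie_eq_zero (h : IsTwoStepSolvable K L) {a b : L}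
    (ha : a ∈ LieAlgebra.derivedSeries K L 1) (hb : b ∈ LieAlgebra.derivedSeries K L 1) :
    ⁅a, b⁆ = 0 := by
  have h1 : ⁅a, b⁆ ∈ LieAlgebra.derivedSeries K L 2 := by
    rw [LieAlgebra.derivedSeries_def, LieAlgebra.derivedSeriesOfIdeal_succ]
    exact LieSubmodule.lie_mem_lie ha hb
  rwa [h, LieSubmodule.mem_bot] at h1

/-- If `x` and `y` generate `L`, and `N` is a subspace with `[N, N] = 0` containing
`⁅x, y⁆` and stable under `ad x` and `ad y`, then `L = ⟨x, y⟩ + N` and `[L, L] ⊆ N`. -/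
theorem exists_eq_add_of_lieSpan_eq_top {x y : L} (hgen : LieSubalgebra.lieSpan K L {x, y} = ⊤)
    (N : Submodule K L) (hab : ∀ a ∈ N, ∀ b ∈ N, ⁅a, b⁆ = 0) (hxy : ⁅x, y⁆ ∈ N)
    (hx : ∀ a ∈ N, ⁅x, a⁆ ∈ N) (hy : ∀ a ∈ N, ⁅y, a⁆ ∈ N) :
    (∀ u : L, ∃ r s : K, ∃ a ∈ N, u = r • x + s • y + a) ∧
      ∀ u ∈ LieAlgebra.derivedSeries K L 1, u ∈ N := by
  have hbr : ∀ r s r' s' : K, ∀ a ∈ N, ∀ b ∈ N,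
      ⁅r • x + s • y + a, r' • x + s' • y + b⁆ ∈ N := by
    intro r s r' s' a ha b hb
    have h1 : ⁅r • x + s • y + a, r' • x + s' • y + b⁆ = (r * s' - s * r') • ⁅x, y⁆
        + (r • ⁅x, b⁆ + s • ⁅y, b⁆) - (r' • ⁅x, a⁆ + s' • ⁅y, a⁆) := by
      simp only [add_lie, lie_add, smul_lie, lie_smul, lie_self, hab a ha b hb]
      rw [← lie_skew x y, ← lie_skew x a, ← lie_skew y a]
      module
    rw [h1]
    exact N.sub_mem (N.add_mem (N.smul_mem _ hxy)
      (N.add_mem (N.smul_mem _ (hx b hb)) (N.smul_mem _ (hy b hb))))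
      (N.add_mem (N.smul_mem _ (hx a ha)) (N.smul_mem _ (hy a ha)))
  have hspan : ∀ u : L, ∃ r s : K, ∃ a ∈ N, u = r • x + s • y + a := by
    let S : LieSubalgebra K L :=
      { carrier := {u | ∃ r s : K, ∃ a ∈ N, u = r • x + s • y + a}
        add_mem' := by
          rintro _ _ ⟨r, s, a, ha, rfl⟩ ⟨r', s', b, hb, rfl⟩
          exact ⟨r + r', s + s', a + b, N.add_mem ha hb, by module⟩
        zero_mem' := ⟨0, 0, 0, N.zero_mem, by simp⟩
        smul_mem' := by
          rintro c _ ⟨r, s, a, ha, rfl⟩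
          exact ⟨c * r, c * s, c • a, N.smul_mem _ ha, by module⟩
        lie_mem' := by
          rintro _ _ ⟨r, s, a, ha, rfl⟩ ⟨r', s', b, hb, rfl⟩
          exact ⟨0, 0, _, hbr r s r' s' a ha b hb, by simp⟩ }
    have hS : (⊤ : LieSubalgebra K L) ≤ S := by
      rw [← hgen, LieSubalgebra.lieSpan_le]
      rintro u (rfl | rfl)
      · exact ⟨1, 0, 0, N.zero_mem, by simp⟩
      · exact ⟨0, 1, 0, N.zero_mem, by simp⟩
    exact fun u ↦ hS (LieSubalgebra.mem_top u)
  refine ⟨hspan, ?_⟩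
  let I : LieIdeal K L :=
    { N with
      lie_mem := by
        intro u a ha
        obtain ⟨r, s, b, hb, rfl⟩ := hspan u
        have := hbr r s 0 0 b hb a ha
        simpa using this }
  have hI : LieAlgebra.derivedSeries K L 1 ≤ I := by
    rw [LieAlgebra.derivedSeries_def, LieAlgebra.derivedSeriesOfIdeal_succ,
      LieAlgebra.derivedSeriesOfIdeal_zero, LieSubmodule.lie_le_iff]
    intro u _ v _
    obtain ⟨r, s, a, ha, rfl⟩ := hspan u
    obtain ⟨r', s', b, hb, rfl⟩ := hspan v
    exact hbr r s r' s' a ha b hb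
  exact fun u hu ↦ hI hu

end LRStructures

theorem theorem4p3 (K L : Type*) [Field K] [CharZero K] [LieRing L] [LieAlgebra K L]
    [FiniteDimensional K L] (hgen : IsTwoGenerated K L) (hsolv : IsTwoStepSolvable K L) :
    ∃ μ : L →ₗ[K] L →ₗ[K] L, IsCompleteLRStructure μ := by
  obtain ⟨x, y, hxy⟩ := hgen
  let M : LieIdeal K L := LieAlgebra.derivedSeries K L 1
  have hlie : ∀ u v : L, ⁅u, v⁆ ∈ M := lie_mem_derivedSeries_one
  have hab : ∀ a ∈ M, ∀ b ∈ M, ⁅a, b⁆ = 0 := fun a ha b hb ↦ hsolv.lie_eq_zero ha hb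
  have hdec : ∀ u : L, ∃ r s : K, ∃ a ∈ M, u = r • x + s • y + a :=
    (exists_eq_add_of_lieSpan_eq_top hxy M.toSubmodule hab (hlie x y)
      (fun a _ ↦ hlie x a) (fun a _ ↦ hlie y a)).1
  by_cases hind : ∀ r s : K, r • x + s • y ∈ M → r = 0 ∧ s = 0
  swap
  · push Not at hind
    obtain ⟨r, s, hrs, h0⟩ := hind
    by_cases hr : r = 0
    · have hs := h0 hr
      refine exists_isCompleteLRStructure_of_codim_le_one M hab x fun u ↦ ?_
      obtain ⟨r', s', a, ha, rfl⟩ := hdec u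
      refine ⟨r', _, M.add_mem (M.smul_mem (s' * s⁻¹) hrs) ha, ?_⟩
      rw [hr, zero_smul, zero_add, smul_smul, inv_mul_cancel_right₀ hs, add_assoc]
    · refine exists_isCompleteLRStructure_of_codim_le_one M hab y fun u ↦ ?_
      obtain ⟨r', s', a, ha, rfl⟩ := hdec u
      refine ⟨s' - r' * r⁻¹ * s, _, M.add_mem (M.smul_mem (r' * r⁻¹) hrs) ha, ?_⟩
      rw [smul_add, smul_smul, inv_mul_cancel_right₀ hr]
      module
  let X : Module.End K M := LieModule.toEnd K L M x
  let Y : Module.End K M := LieModule.toEnd K L M y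
  have hX : ∀ a : M, ((X a : M) : L) = ⁅x, (a : L)⁆ := fun _ ↦ rfl
  have hY : ∀ a : M, ((Y a : M) : L) = ⁅y, (a : L)⁆ := fun _ ↦ rfl
  -- By Jacobi the commutator is ad [x, y], which vanishes on the abelian ideal M.
  have hXY : X * Y = Y * X := by
    ext a
    rw [Module.End.mul_apply, Module.End.mul_apply, hX, hY, hY, hX, leibniz_lie x y,
      hab _ (hlie x y) _ a.2, zero_add]
  obtain ⟨A, _, _, ρ, x', y', hρ, hx', hy'⟩ := exists_commRing_injective_algHom_end X Y hXY
  have : FiniteDimensional K A := FiniteDimensional.of_injective ρ.toLinearMap hρ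
  let w : M := ⟨⁅x, y⁆, hlie x y⟩
  let e : A →ₗ[K] L := M.toSubmodule.subtype ∘ₗ LinearMap.applyₗ w ∘ₗ ρ.toLinearMap
  have he : ∀ a, e a = (ρ a w : M) := fun _ ↦ rfl
  have heM : ∀ a, e a ∈ M := fun a ↦ (ρ a w).2
  have hex : ∀ a, ⁅x, e a⁆ = e (x' * a) := fun a ↦ by
    rw [he, he, map_mul, hx', Module.End.mul_apply, hX]
  have hey : ∀ a, ⁅y, e a⁆ = e (y' * a) := fun a ↦ by
    rw [he, he, map_mul, hy', Module.End.mul_apply, hY]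
  have he1 : e 1 = ⁅x, y⁆ := by rw [he, map_one, Module.End.one_apply]
  -- Second use of this lemma, now with the smaller subspace A w: it gives M = A w, so M is cyclic.
  have hrange := exists_eq_add_of_lieSpan_eq_top hxy (LinearMap.range e)
    (by rintro _ ⟨a, rfl⟩ _ ⟨b, rfl⟩; exact hab _ (heM a) _ (heM b)) ⟨1, he1⟩
    (by rintro _ ⟨a, rfl⟩; exact ⟨_, (hex a).symm⟩)
    (by rintro _ ⟨a, rfl⟩; exact ⟨_, (hey a).symm⟩)
  -- An element killing the generator w kills all of M = A w by commutativity, and A acts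
  -- faithfully.
  have heinj : ∀ a, e a = 0 → a = 0 := by
    intro a ha
    have ha' : ρ a w = 0 := Subtype.ext ha
    refine hρ (LinearMap.ext fun m ↦ ?_)
    obtain ⟨b, hb⟩ := hrange.2 m m.2
    have hb' : m = ρ b w := Subtype.ext hb.symm
    rw [hb', ← Module.End.mul_apply, ← map_mul, mul_comm, map_mul, Module.End.mul_apply, ha',
      map_zero, map_zero, LinearMap.zero_apply]
  let Φ : (K × K × A) →ₗ[K] L := (LinearMap.toSpanSingleton K L x).coprod
    ((LinearMap.toSpanSingleton K L y).coprod e)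
  have hΦ : ∀ r s a, Φ (r, s, a) = r • x + s • y + e a := fun r s a ↦ by
    simp [Φ, add_assoc]
  have hbij : Function.Bijective Φ := by
    constructor
    · rw [injective_iff_map_eq_zero]
      rintro ⟨r, s, a⟩ h
      rw [hΦ] at h
      have hmem : r • x + s • y ∈ M := by
        rw [eq_neg_of_add_eq_zero_left h]; exact M.neg_mem (heM a)
      obtain ⟨rfl, rfl⟩ := hind r s hmem
      rw [zero_smul, zero_smul, zero_add, zero_add] at h
      rw [heinj a h]; rfl
    · intro u
      obtain ⟨r, s, _, ⟨a, rfl⟩, rfl⟩ := hrange.1 u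
      exact ⟨(r, s, a), hΦ r s a⟩
  let Ψ : L ≃ₗ[K] (K × K × A) := (LinearEquiv.ofBijective Φ hbij).symm
  have hΨ : ∀ r s a, Ψ (r • x + s • y + e a) = (r, s, a) := fun r s a ↦ by
    rw [← hΦ]; exact (LinearEquiv.ofBijective Φ hbij).symm_apply_apply (r, s, a)
  have hΨe : ∀ a, Ψ (e a) = (0, 0, a) := fun a ↦ by simpa using hΨ 0 0 a
  refine exists_isCompleteLRStructure_of_coordinates x' y' e
    (LinearMap.fst K K (K × A) ∘ₗ Ψ.toLinearMap)
    (LinearMap.fst K K A ∘ₗ LinearMap.snd K K (K × A) ∘ₗ Ψ.toLinearMap)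
    (LinearMap.snd K K A ∘ₗ LinearMap.snd K K (K × A) ∘ₗ Ψ.toLinearMap)
    (fun a ↦ by simp [hΨe]) (fun a ↦ by simp [hΨe]) (fun a ↦ by simp [hΨe]) fun u v ↦ ?_
  obtain ⟨r, s, _, ⟨a, rfl⟩, rfl⟩ := hrange.1 u
  obtain ⟨r', s', _, ⟨b, rfl⟩, rfl⟩ := hrange.1 v
  simp only [LinearMap.comp_apply, LinearEquiv.coe_coe, hΨ, LinearMap.fst_apply,
    LinearMap.snd_apply]
  simp only [Algebra.algebraMap_eq_smul_one, mul_sub, mul_smul_comm, map_add, map_sub,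
    map_smul, he1, ← hex, ← hey]
  simp only [add_lie, lie_add, smul_lie, lie_smul, lie_self, hab _ (heM a) _ (heM b)]
  rw [← lie_skew y x, ← lie_skew (e a) x, ← lie_skew (e a) y]
  module
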